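/- **Conventions.** For a partial map $U$ on $\{0,1\}^*$ put $\mathrm C_U(x)=\min\{|p| : U(p)=x\}$ ($\infty$ if there is no such $p$); a partial computable $U$ is an *optimal decompressor* if for every partial computable $V$ there is a constant $c$ with $\mathrm C_U(x)\le \mathrm C_V(x)+c$ for all $x$. For a one-tape, one-head Turing machine $M$ whose tape symbols include a blank, $0$, $1$ and an end marker, $\mathrm C^t_M(x)$ is the least length of a $p\in\{0,1\}^*$ such that $M$, started on $p$ followed by the end marker (on an otherwise blank tape), halts after at most $t$ steps with $x$ followed by the end marker on its tape (input and output are read from the head rightwards). $M$ is an *optimal decompression machine* if for every such machine $V$ there are a polynomial $q$ and a constant $c$ with $\mathrm C_M^{q(t)}(x)\le \mathrm C_V^{t}(x)+c$ for all $t,x$. Fix an optimal decompressor $U$ and an optimal decompression machine $M$, and write $\mathrm C=\mathrm C_U$, $\mathrm C^t=\mathrm C^t_M$; the complexity of a binary $n\times n$ pattern is that of the string of its $n^2$ letters read line by line. A *shift* on $\mathbb Z^2$ over $\{0,1\}$ is a nonempty closed subset of $\{0,1\}^{\mathbb Z^2}$ invariant under all translations. It is *effective* if it is the set of configurations in which no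 pattern of some computable set of finite patterns occurs; *minimal* if it contains no proper subshift; *transitive* if for all nonempty (relatively) open subsets $A,B$ of it there is $v\in\mathbb N^2$ with $\sigma^v(A)\cap B\neq\emptyset$, where $(\sigma^v x)(u)=x(v+u)$. A pattern is *globally admissible* if it occurs in some configuration of the shift. **Theorem.** For every computable function $T:\mathbb N\to\mathbb N$ there is an effective, minimal and transitive shift on $\mathbb Z^2$ over the alphabet $\{0,1\}$ such that (i) there is a constant $c_1>0$ such that $\mathrm C(P)\le c_1\log n$ for every $n\ge 2$ and every globally admissible pattern $P$ of size $n\times n$; (ii) there are a constant $c_2>0$ and infinitely many $n$ such that $\mathrm C^{T(n)}(P)\ge c_2\,n^{3/2}$ for every globally admissible pattern $P$ of size $n\times n$. -/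

import Mathlib

open scoped ENNReal

noncomputable section

namespace DeepShift

open SymbolicDynamics.FullShift

/-! ### Plain Kolmogorov complexity -/

/-- `plainComplexity U x` is the least length of a program `p` with `U p = x`
(and `⊤` if there is none), for a decompressor `U`, i.e. a partial map on binary strings. -/
def plainComplexity (U : List Bool →. List Bool) (x : List Bool) : ℕ∞ :=
  ⨅ p ∈ {p : List Bool | x ∈ U p}, (p.length : ℕ∞)

/-- An optimal decompressor: a partial computable `U` such that for every partial computable `V`
the inequality `C_U ≤ C_V + c` holds for a constant `c`. -/
def IsOptimalDecompressor (U : List Bool →. List Bool) : Prop :=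
  Partrec U ∧ ∀ V : List Bool →. List Bool, Partrec V →
    ∃ c : ℕ, ∀ x, plainComplexity U x ≤ plainComplexity V x + c

/-! ### Time-bounded Kolmogorov complexity -/

/-- A Turing machine with one head on one two-way infinite tape. Its tape symbols are `0` (blank),
`1` and `2` (the bits), `3` (the end marker) and finitely many further ones; its initial state
is `0`; it halts when no transition applies. -/
structure Machine where
  /-- number of further tape symbols -/
  extraSymbols : ℕ
  /-- number of states other than the initial one -/
  extraStates : ℕ
  /-- transition table -/
  trans : Turing.TM0.Machine (Fin (extraSymbols + 4)) (Fin (extraStates + 1))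

namespace Machine

/-- A binary string followed by the end marker, as a word over the tape alphabet. -/
def word (M : Machine) (x : List Bool) : List (Fin (M.extraSymbols + 4)) :=
  x.map (fun b => if b then 2 else 1) ++ [3]

/-- Started on the word `word p`, with the head on its first symbol and blanks everywhere else,
the machine halts after at most `t` steps, and then `word x` is written on the tape to the right
of the head, the head being on its first symbol. -/
def OutputsWithin (M : Machine) (t : ℕ) (p x : List Bool) : Prop :=
  ∃ c : Turing.TM0.Cfg (Fin (M.extraSymbols + 4)) (Fin (M.extraStates + 1)),
    Nonempty (StateTransition.EvalsToInTime (Turing.TM0.step M.trans)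
      (Turing.TM0.init (M.word p)) (some c) t) ∧
    Turing.TM0.step M.trans c = none ∧
    ∀ (i : ℕ) (hi : i < (M.word x).length), c.Tape.right₀.nth i = (M.word x)[i]

/-- `M.complexity t x` is the least length of a program from which `M` produces `x` in at most
`t` steps (and `⊤` if there is none). -/
def complexity (M : Machine) (t : ℕ) (x : List Bool) : ℕ∞ :=
  ⨅ p ∈ {p : List Bool | M.OutputsWithin t p x}, (p.length : ℕ∞)

/-- An optimal decompression machine: it simulates every other machine with a polynomial overhead
in time and a constant overhead in program length. -/
def IsOptimal (M : Machine) : Prop :=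
  ∀ V : Machine, ∃ (q : Polynomial ℕ) (c : ℕ), ∀ (t : ℕ) (x : List Bool),
    M.complexity (q.eval t) x ≤ V.complexity t x + c

end Machine

/-! ### Shifts on `ℤ²` -/

/-- A finite pattern, given by the list of its cells with their letters, occurs in the
configuration `x` at position `v`. (A list giving two letters to one cell occurs nowhere.) -/
def OccursAt {A : Type} (F : List ((ℤ × ℤ) × A)) (x : ℤ × ℤ → A) (v : ℤ × ℤ) : Prop :=
  ∀ e ∈ F, x (v + e.1) = e.2

/-- The shift consists of the configurations in which no pattern of some computable set of finite
patterns occurs. -/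
def IsEffective {A : Type} [TopologicalSpace A] [Primcodable A] (S : Subshift A (ℤ × ℤ)) : Prop :=
  ∃ F : List ((ℤ × ℤ) × A) → Prop, ComputablePred F ∧
    S.carrier = {x | ∀ p, F p → ∀ v, ¬ OccursAt p x v}

/-- The shift contains no proper (nonempty) subshift. -/
def IsMinimal {A : Type} [TopologicalSpace A] (S : Subshift A (ℤ × ℤ)) : Prop :=
  ∀ S' : Subshift A (ℤ × ℤ), S'.carrier.Nonempty → S'.carrier ⊆ S.carrier →
    S'.carrier = S.carrier

/-- For all nonempty relatively open subsets `U ∩ S` and `V ∩ S` of the shift `S`, some translate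
of the first one by a vector of `ℕ²` meets the second one. -/
def IsTransitive {A : Type} [TopologicalSpace A] (S : Subshift A (ℤ × ℤ)) : Prop :=
  ∀ U V : Set (ℤ × ℤ → A), IsOpen U → IsOpen V →
    (U ∩ S.carrier).Nonempty → (V ∩ S.carrier).Nonempty →
    ∃ a b : ℕ, (shift ((a : ℤ), (b : ℤ)) '' (U ∩ S.carrier) ∩ (V ∩ S.carrier)).Nonempty

/-- The `n × n` pattern `P` is globally admissible: it occurs in a configuration of the shift. -/
def GloballyAdmissible {A : Type} [TopologicalSpace A] (S : Subshift A (ℤ × ℤ)) {n : ℕ}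
    (P : Fin n → Fin n → A) : Prop :=
  ∃ x ∈ S.carrier, ∃ v : ℤ × ℤ, ∀ i j : Fin n, x (v + ((i : ℤ), (j : ℤ))) = P i j

/-- The code of a binary `n × n` pattern: the string of its `n ^ 2` letters, line by line. -/
def code {n : ℕ} (P : Fin n → Fin n → Bool) : List Bool :=
  (List.ofFn fun i => List.ofFn (P i)).flatten

end DeepShift

end

noncomputable section

namespace DeepShift

open SymbolicDynamics.FullShift

/-! ### Hierarchical words -/

/-! Blocks are built in levels. A block of level `k + 1` is an `N × N` array, `N = ratio k`, each of
whose entries is the block of level `k` or its complement. The signs in the first eight rows come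
from a fixed patch; the remaining `(N - 8) * N` signs form a free word `w k`. The shift consists of
the configurations in which every window of side `side k` lies in some `2 × 2` array of signed
level-`k` blocks, for all `k`. It is nonempty by compactness, whatever the words are.

Minimality and transitivity come from the patch. It contains every `2 × 2` array of signs, so every
level-`k` window that can occur at all occurs in every block of level `k + 1`, and such blocks occur
in every large enough window (`Legal.exists_combo`). Hence finite parts of one configuration recur
in any other, at a position in the positive quadrant (`exists_shift_eqOn`).

Hardness comes from the words. With `L = side k`, the word `w k` has about `64 * L ^ 6` bits, and
the next side is `8 * L ^ 4`. By counting, some word gives a block that no program shorter than `32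
* L ^ 6` produces, within the allowed time, as part of a pattern of side `n = 2 * side (k + 1)`
(`exists_not_isSimple`); the first such word is taken. Every admissible pattern of side `n` contains
this block or its complement, and `32 * L ^ 6` is exactly half of `n ^ (3 / 2)`
(`bound_le_complexity`, `half_mul_rpow_eq_bound`).

The search for the words is long but computable, since the time bound is. The shift is therefore
effective (`isEffective_blockShift`), and without a time bound an admissible pattern is determined
by its size, a level, an offset and four signs. Sides grow polynomially from level to level, so
these data take `O(log n)` bits (`exists_decompress_eq`). -/

/-- Side length of the blocks of level `k`. -/
def side : ℕ → ℕ
  | 0 => 1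
  | k + 1 => 8 * side k ^ 4

/-- Number of blocks of level `k` along a side of a block of level `k + 1`. -/
def ratio (k : ℕ) : ℕ := 8 * side k ^ 3

/-- A `5 × 5` array of letters, in which each `2 × 2` array occurs. -/
def patch (i j : ℕ) : Bool :=
  [true, true, true, false, true,
   true, true, false, true, true,
   false, true, false, false, false,
   true, false, false, false, true,
   true, true, true, false, true].getD (5 * i + j) false

/-- The `N × N` array with upper part `patch` whose other letters are those of the word `w`. -/
def entry (w : List Bool) (N i j : ℕ) : Bool :=
  if i < 8 then patch i j else w.getD ((i - 8) * N + j) false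

/-- The letter at `(i, j)` of the block of level `k` (extended periodically). The block of level
`k + 1` is the array `entry (w k)`, where a letter stands for the block of level `k` or for its
complement. -/
def letter (w : ℕ → List Bool) : ℕ → ℕ → ℕ → Bool
  | 0, _, _ => false
  | k + 1, i, j => letter w k i j ^^
      entry (w k) (ratio k) (i / side k % ratio k) (j / side k % ratio k)

/-- The entries of a `2 × 2` array. -/
def sel (q : Bool × Bool × Bool × Bool) (a b : Bool) : Bool :=
  bif a then (bif b then q.2.2.2 else q.2.2.1) else (bif b then q.2.1 else q.1)

/-- The letter at `(i + r, j + s)` of a `2 × 2` array of blocks of level `k` with signs `q`. -/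
def combo (w : ℕ → List Bool) (k i j : ℕ) (q : Bool × Bool × Bool × Bool) (r s : ℕ) : Bool :=
  sel q (decide (side k ≤ i + r)) (decide (side k ≤ j + s)) ^^ letter w k (i + r) (j + s)

/-- Each window of `x` with the side of level `k` is a window of a `2 × 2` array of blocks. -/
def Legal (w : ℕ → List Bool) (k : ℕ) (x : ℤ × ℤ → Bool) : Prop :=
  ∀ v : ℤ × ℤ, ∃ i < side k, ∃ j < side k, ∃ q, ∀ r < side k, ∀ s < side k,
    x (v + ((r : ℤ), (s : ℤ))) = combo w k i j q r s

/-! ### Arithmetic of the sides, periodicity of the letters, recurrence of windows. -/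

theorem side_pos (k : ℕ) : 0 < side k := by
  induction k with
  | zero => simp [side]
  | succ k ih => simp only [side]; positivity

theorem side_succ (k : ℕ) : side (k + 1) = side k * ratio k := by
  simp only [side, ratio]; ring

theorem eight_le_ratio (k : ℕ) : 8 ≤ ratio k := by
  have := pow_pos (side_pos k) 3
  unfold ratio; omega

theorem eight_mul_side_le (k : ℕ) : 8 * side k ≤ side (k + 1) := by
  rw [side_succ, mul_comm]; exact Nat.mul_le_mul_left _ (eight_le_ratio k)

theorem lt_side (k : ℕ) : k < side k := by
  induction k with
  | zero => simp [side]
  | succ k ih => have := eight_mul_side_le k; omega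

theorem side_strictMono : StrictMono side :=
  strictMono_nat_of_lt_succ fun k => by
    have := eight_mul_side_le k
    have := side_pos k
    omega

theorem sel_surjective (g : Bool → Bool → Bool) : ∃ q, ∀ a b, sel q a b = g a b :=
  ⟨(g false false, g false true, g true false, g true true), by
    intro a b; cases a <;> cases b <;> rfl⟩

/-- A finite check over the sixteen sign arrays. It is the source of minimality: all of them occur
in a corner that every block contains. -/
theorem exists_patch_eq : ∀ q : Bool × Bool × Bool × Bool, ∃ i < 4, ∃ j < 4, ∀ a b : Bool,
    patch (i + a.toNat) (j + b.toNat) = sel q a b := by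
  decide

theorem letter_congr {w w' : ℕ → List Bool} {k : ℕ} (h : ∀ m < k, w m = w' m) (i j : ℕ) :
    letter w k i j = letter w' k i j := by
  induction k with
  | zero => rfl
  | succ k ih =>
    simp only [letter]
    rw [ih fun m hm => h m (by omega), h k (by omega)]

theorem letter_add_mul (w : ℕ → List Bool) (k i j a b : ℕ) :
    letter w k (i + side k * a) (j + side k * b) = letter w k i j := by
  induction k generalizing a b with
  | zero => rfl
  | succ k ih =>
    simp only [letter]
    rw [side_succ, mul_assoc, mul_assoc, ih]
    congr 2
    all_goals rw [Nat.add_mul_div_left _ _ (side_pos k), Nat.add_mul_mod_self_left]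

theorem letter_mod_add (w : ℕ → List Bool) (k i j r s : ℕ) :
    letter w k (i % side k + r) (j % side k + s) = letter w k (i + r) (j + s) := by
  rw [← letter_add_mul w k (i % side k + r) (j % side k + s) (i / side k) (j / side k)]
  congr 1
  · have := Nat.mod_add_div i (side k); omega
  · have := Nat.mod_add_div j (side k); omega

theorem add_div_of_lt {L i r : ℕ} (hr : r < L) :
    (i + r) / L = i / L + (decide (L ≤ i % L + r)).toNat := by
  rw [Nat.add_div (by omega), Nat.div_eq_of_lt hr, Nat.mod_eq_of_lt hr]
  by_cases h : L ≤ i % L + r <;> simp [h]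

theorem side_succ_le_iff (k n : ℕ) : side (k + 1) ≤ n ↔ ratio k ≤ n / side k := by
  rw [Nat.le_div_iff_mul_le (side_pos k), side_succ, mul_comm]

/-- A `2 × 2` array of blocks of level `k + 1` is an array of signed blocks of level `k`, and a
window of side `side k` meets at most two rows and two columns of these. The new signs combine the
outer signs with the entries of the array. -/
theorem Legal.of_succ {w : ℕ → List Bool} {k : ℕ} {x : ℤ × ℤ → Bool} (h : Legal w (k + 1) x) :
    Legal w k x := by
  intro v
  obtain ⟨i, hi, j, hj, q, hq⟩ := h v
  obtain ⟨q', hq'⟩ := sel_surjective fun a b =>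
    sel q (decide (ratio k ≤ i / side k + a.toNat)) (decide (ratio k ≤ j / side k + b.toNat)) ^^
      entry (w k) (ratio k) ((i / side k + a.toNat) % ratio k) ((j / side k + b.toNat) % ratio k)
  refine ⟨i % side k, Nat.mod_lt _ (side_pos k), j % side k, Nat.mod_lt _ (side_pos k), q', ?_⟩
  intro r hr s hs
  have := eight_mul_side_le k
  rw [hq r (by omega) s (by omega), combo, combo, hq']
  simp only [side_succ_le_iff, letter, letter_mod_add]
  rw [add_div_of_lt hr, add_div_of_lt hs, Bool.xor_assoc]
  congr 1
  exact Bool.xor_comm _ _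

theorem exists_add_eq_mul {L : ℕ} (hL : 0 < L) (i : ℕ) : ∃ d < L, ∃ a, i + d = L * a := by
  refine ⟨(L - i % L) % L, Nat.mod_lt _ hL, Nat.dvd_of_mod_eq_zero ?_⟩
  rw [Nat.add_mod, Nat.mod_mod, ← Nat.add_mod]
  have h := Nat.mod_add_div i L
  have h2 := Nat.mod_lt i hL
  have : i + (L - i % L) = L * (i / L + 1) := by rw [mul_add]; omega
  rw [this, Nat.mul_mod_right]

/-- Each window of twice the side of level `k` contains an aligned block of level `k`. -/
theorem Legal.exists_block {w : ℕ → List Bool} {k : ℕ} {x : ℤ × ℤ → Bool}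
    (h : Legal w (k + 1) x) (v : ℤ × ℤ) :
    ∃ i < side k, ∃ j < side k, ∃ b : Bool, ∀ r < side k, ∀ s < side k,
      x (v + (((i + r : ℕ) : ℤ), ((j + s : ℕ) : ℤ))) = (b ^^ letter w k r s) := by
  obtain ⟨i', hi', j', hj', q, hq⟩ := h v
  -- The block starts at the first grid line of level `k` at or after the offset of the window; it
  -- ends before `2 * side k`, hence inside the window of level `k + 1`.
  obtain ⟨i, hi, a, ha⟩ := exists_add_eq_mul (side_pos k) i'
  obtain ⟨j, hj, b, hb⟩ := exists_add_eq_mul (side_pos k) j'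
  refine ⟨i, hi, j, hj, sel q (decide (ratio k ≤ a)) (decide (ratio k ≤ b)) ^^
    entry (w k) (ratio k) (a % ratio k) (b % ratio k), ?_⟩
  intro r hr s hs
  have := eight_mul_side_le k
  rw [hq _ (by omega) _ (by omega), combo, ← add_assoc, ← add_assoc, ha, hb, add_comm _ r,
    add_comm _ s]
  simp only [side_succ_le_iff, letter, letter_add_mul]
  rw [Nat.add_mul_div_left _ _ (side_pos k), Nat.add_mul_div_left _ _ (side_pos k),
    Nat.div_eq_of_lt hr, Nat.div_eq_of_lt hs, zero_add, zero_add, Bool.xor_assoc]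
  congr 1
  exact Bool.xor_comm _ _

/-- All windows of `2 × 2` arrays of blocks recur. -/
theorem Legal.exists_combo {w : ℕ → List Bool} {k : ℕ} {x : ℤ × ℤ → Bool}
    (h : Legal w (k + 2) x) (v : ℤ × ℤ) {i j : ℕ} (hi : i < side k) (hj : j < side k)
    (q : Bool × Bool × Bool × Bool) :
    ∃ a b : ℕ, ∀ r < side k, ∀ s < side k,
      x (v + (((a + r : ℕ) : ℤ), ((b + s : ℕ) : ℤ))) = combo w k i j q r s := by
  obtain ⟨a, -, b, -, c, hc⟩ := h.exists_block v
  -- The block of level `k + 1` is known only up to its sign `c`, so the patch is searched for the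
  -- signs `q` corrected by `c`.
  obtain ⟨q', hq'⟩ := sel_surjective fun a b => c ^^ sel q a b
  obtain ⟨m, hm, n, hn, hmn⟩ := exists_patch_eq q'
  refine ⟨a + (i + side k * m), b + (j + side k * n), fun r hr s hs => ?_⟩
  have h8 := eight_mul_side_le k
  have h9 := eight_le_ratio k
  have hm' : side k * m ≤ side k * 3 := Nat.mul_le_mul_left _ (by omega)
  have hn' : side k * n ≤ side k * 3 := Nat.mul_le_mul_left _ (by omega)
  rw [add_assoc a, add_assoc b, hc _ (by omega) _ (by omega), add_right_comm i,
    add_right_comm j]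
  simp only [letter, letter_add_mul]
  rw [Nat.add_mul_div_left _ _ (side_pos k), Nat.add_mul_div_left _ _ (side_pos k),
    add_div_of_lt hr, add_div_of_lt hs, Nat.div_eq_of_lt hi, Nat.div_eq_of_lt hj,
    Nat.mod_eq_of_lt hi, Nat.mod_eq_of_lt hj, zero_add, zero_add, add_comm _ m, add_comm _ n]
  have e1 := Bool.toNat_le (decide (side k ≤ i + r))
  have e2 := Bool.toNat_le (decide (side k ≤ j + s))
  rw [Nat.mod_eq_of_lt (by omega), Nat.mod_eq_of_lt (by omega), entry, if_pos (by omega), hmn,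
    hq', combo, Bool.xor_left_comm, ← Bool.xor_assoc c, Bool.xor_self, Bool.false_xor,
    Bool.xor_comm]

/-! ### The shift -/

theorem isClosed_legal (w : ℕ → List Bool) (k : ℕ) : IsClosed {x | Legal w k x} := by
  have : {x | Legal w k x} = ⋂ v : ℤ × ℤ, ⋃ c : Fin (side k) × Fin (side k) ×
      (Bool × Bool × Bool × Bool), ⋂ r : Fin (side k), ⋂ s : Fin (side k),
        {x : ℤ × ℤ → Bool | x (v + ((r : ℤ), (s : ℤ))) = combo w k c.1 c.2.1 c.2.2 r s} := by
    ext x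
    simp only [Legal, Set.mem_ofPred_eq, Set.mem_iInter, Set.mem_iUnion]
    refine forall_congr' fun v => ⟨?_, ?_⟩
    · rintro ⟨i, hi, j, hj, q, h⟩
      exact ⟨⟨⟨i, hi⟩, ⟨j, hj⟩, q⟩, fun r s => h r r.2 s s.2⟩
    · rintro ⟨⟨i, j, q⟩, h⟩
      exact ⟨i, i.2, j, j.2, q, fun r hr s hs => h ⟨r, hr⟩ ⟨s, hs⟩⟩
  rw [this]
  exact isClosed_iInter fun v => isClosed_iUnion_of_finite fun c => isClosed_iInter fun r =>
    isClosed_iInter fun s => isClosed_eq (continuous_apply _) continuous_const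

/-- The plane is tiled periodically by the block of level `k`, all signs being `false`. -/
theorem exists_legal (w : ℕ → List Bool) (k : ℕ) : ∃ x, Legal w k x := by
  have hL : (0 : ℤ) < side k := by exact_mod_cast side_pos k
  have key (z : ℤ) (r : ℕ) : ∃ a : ℕ,
      (z % side k).toNat + r = ((z + r) % side k).toNat + side k * a := by
    refine ⟨((z % side k).toNat + r) / side k, ?_⟩
    have : ((z + r) % side k).toNat = ((z % side k).toNat + r) % side k := by
      zify
      rw [Int.toNat_of_nonneg (Int.emod_nonneg _ hL.ne'),
        Int.toNat_of_nonneg (Int.emod_nonneg _ hL.ne'), Int.emod_add_emod]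
    rw [this, Nat.mod_add_div]
  refine ⟨fun u => letter w k (u.1 % side k).toNat (u.2 % side k).toNat, fun v => ?_⟩
  have lt (z : ℤ) : (z % side k).toNat < side k := by
    zify
    rw [Int.toNat_of_nonneg (Int.emod_nonneg _ hL.ne')]
    exact Int.emod_lt_of_pos _ hL
  refine ⟨_, lt v.1, _, lt v.2, (false, false, false, false), fun r hr s hs => ?_⟩
  obtain ⟨a, ha⟩ := key v.1 r
  obtain ⟨b, hb⟩ := key v.2 s
  rw [combo, ha, hb, letter_add_mul]
  simp [sel]

/-- The shift of the configurations that are legal at all levels. -/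
def blockShift (w : ℕ → List Bool) : Subshift Bool (ℤ × ℤ) where
  carrier := {x | ∀ k, Legal w k x}
  isClosed := by
    rw [Set.ofPred_forall]
    exact isClosed_iInter fun k => isClosed_legal w k
  mapsTo g x hx k v := by
    obtain ⟨i, hi, j, hj, q, h⟩ := hx k (g + v)
    refine ⟨i, hi, j, hj, q, fun r hr s hs => ?_⟩
    rw [← h r hr s hs, shift_apply, add_assoc]

theorem blockShift_nonempty (w : ℕ → List Bool) : (blockShift w).carrier.Nonempty := by
  have := IsCompact.nonempty_iInter_of_sequence_nonempty_isCompact_isClosed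
    (fun k => {x | Legal w k x}) (fun k x hx => Legal.of_succ hx) (exists_legal w)
    (isClosed_legal w 0).isCompact (isClosed_legal w)
  simpa only [blockShift, Set.ofPred_forall] using this

/-- Finite parts of a configuration of the shift recur in all configurations of the shift. -/
theorem exists_shift_eqOn {w : ℕ → List Bool} {x y : ℤ × ℤ → Bool}
    (hx : x ∈ (blockShift w).carrier) (hy : y ∈ (blockShift w).carrier)
    (I : Finset (ℤ × ℤ)) :
    ∃ a b : ℕ, ∀ u ∈ I, shift ((a : ℤ), (b : ℤ)) x u = y u := by
  obtain ⟨K, hK⟩ : ∃ K : ℕ, ∀ u ∈ I, u.1.natAbs ≤ K ∧ u.2.natAbs ≤ K :=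
    ⟨I.sup fun u => max u.1.natAbs u.2.natAbs, fun u hu =>
      max_le_iff.1 (Finset.le_sup (f := fun u : ℤ × ℤ => max u.1.natAbs u.2.natAbs) hu)⟩
  -- Level `2 * K` suffices: the square from `-K` to `K` has side `2 * K + 1 ≤ side (2 * K)`.
  obtain ⟨i, hi, j, hj, q, hq⟩ := hy (2 * K) (-(K : ℤ), -(K : ℤ))
  obtain ⟨a, b, hab⟩ := Legal.exists_combo (hx (2 * K + 2)) (-(K : ℤ), -(K : ℤ)) hi hj q
  refine ⟨a, b, fun u hu => ?_⟩
  have hu' := hK u hu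
  have hk := lt_side (2 * K)
  have h1 := hab (u.1 + K).toNat (by omega) (u.2 + K).toNat (by omega)
  rw [← hq (u.1 + K).toNat (by omega) (u.2 + K).toNat (by omega)] at h1
  convert h1 using 1
  · rw [shift_apply]
    congr 1
    ext <;> simp <;> omega
  · congr 1
    ext <;> simp <;> omega

theorem isMinimal_blockShift (w : ℕ → List Bool) : IsMinimal (blockShift w) := by
  rintro S ⟨x, hx⟩ hS
  refine hS.antisymm fun y hy => ?_
  rw [← S.isClosed.closure_eq, mem_closure_iff]
  intro V hV hyV
  obtain ⟨I, u, hu, hIu⟩ := isOpen_pi_iff.1 hV y hyV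
  obtain ⟨a, b, hab⟩ := exists_shift_eqOn (hS hx) hy I
  exact ⟨_, hIu fun z hz => by rw [hab z hz]; exact (hu z hz).2, S.mapsTo _ hx⟩

theorem isTransitive_blockShift (w : ℕ → List Bool) : IsTransitive (blockShift w) := by
  rintro U V - hV ⟨x, hxU, hx⟩ ⟨y, hyV, hy⟩
  obtain ⟨I, u, hu, hIu⟩ := isOpen_pi_iff.1 hV y hyV
  obtain ⟨a, b, hab⟩ := exists_shift_eqOn hx hy I
  exact ⟨a, b, _, ⟨x, ⟨hxU, hx⟩, rfl⟩,
    hIu fun z hz => by rw [hab z hz]; exact (hu z hz).2, (blockShift w).mapsTo _ hx⟩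

/-! ### Simulation of machines on lists -/

namespace Machine

variable (M : Machine)

/-- The kind of action of a machine: halt, move left, move right or write. -/
def actKind (c : Fin (M.extraStates + 1) × Fin (M.extraSymbols + 4)) : ℕ :=
  match M.trans c.1 c.2 with
  | none => 0
  | some (_, .move .left) => 1
  | some (_, .move .right) => 2
  | some (_, .write _) => 3

/-- The next state. -/
def actState (c : Fin (M.extraStates + 1) × Fin (M.extraSymbols + 4)) :
    Fin (M.extraStates + 1) :=
  match M.trans c.1 c.2 with
  | none => c.1
  | some (q, _) => q

/-- The symbol written. -/
def actSymbol (c : Fin (M.extraStates + 1) × Fin (M.extraSymbols + 4)) :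
    Fin (M.extraSymbols + 4) :=
  match M.trans c.1 c.2 with
  | some (_, .write a) => a
  | _ => c.2

/-- A configuration: the state, the tape to the left of the head (read leftwards), and the
tape from the head rightwards. -/
abbrev ListCfg : Type :=
  Fin (M.extraStates + 1) × List (Fin (M.extraSymbols + 4)) × List (Fin (M.extraSymbols + 4))

/-- One step of the machine; halting configurations are fixed. -/
def listStep (c : M.ListCfg) : M.ListCfg :=
  if M.actKind (c.1, c.2.2.headI) = 0 then c
  else if M.actKind (c.1, c.2.2.headI) = 1 then
    (M.actState (c.1, c.2.2.headI), c.2.1.tail, c.2.1.headI :: c.2.2)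
  else if M.actKind (c.1, c.2.2.headI) = 2 then
    (M.actState (c.1, c.2.2.headI), c.2.2.headI :: c.2.1, c.2.2.tail)
  else (M.actState (c.1, c.2.2.headI), c.2.1, M.actSymbol (c.1, c.2.2.headI) :: c.2.2.tail)

/-- The configuration of the machine represented by lists. -/
def toCfg (c : M.ListCfg) :
    Turing.TM0.Cfg (Fin (M.extraSymbols + 4)) (Fin (M.extraStates + 1)) :=
  ⟨c.1, Turing.Tape.mk' (Turing.ListBlank.mk c.2.1) (Turing.ListBlank.mk c.2.2)⟩

theorem toCfg_listStep (c : M.ListCfg) :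
    M.toCfg (M.listStep c) = (Turing.TM0.step M.trans (M.toCfg c)).getD (M.toCfg c) := by
  obtain ⟨q, l, r⟩ := c
  have hh : (Turing.Tape.mk' (Turing.ListBlank.mk l) (Turing.ListBlank.mk r)).head = r.headI := by
    simp
  rcases e : M.trans q r.headI with _ | ⟨q', (_ | _) | a⟩ <;>
    simp [toCfg, listStep, Turing.TM0.step, actKind, actState, actSymbol, e,
      Turing.Tape.move_left_mk', Turing.Tape.move_right_mk', Turing.Tape.write_mk']

/-- Since `listStep` fixes halting configurations, running exactly `t` steps reaches the result of
any computation that halts within `t` steps. This makes the time-bounded output a total function. -/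
theorem toCfg_iterate_listStep (c : M.ListCfg) (n t : ℕ) (hnt : n ≤ t)
    (d : Turing.TM0.Cfg (Fin (M.extraSymbols + 4)) (Fin (M.extraStates + 1)))
    (hd : Turing.TM0.step M.trans d = none)
    (h : (flip bind (Turing.TM0.step M.trans))^[n] (some (M.toCfg c)) = some d) :
    M.toCfg (M.listStep^[t] c) = d := by
  induction t generalizing n c with
  | zero =>
    obtain rfl : n = 0 := by omega
    simpa using h
  | succ t ih =>
    rw [Function.iterate_succ_apply]
    cases n with
    | zero =>
      refine ih _ 0 (by omega) ?_
      have h' : M.toCfg c = d := by simpa using h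
      simp [toCfg_listStep, h', hd]
    | succ n =>
      refine ih _ n (by omega) ?_
      rw [Function.iterate_succ_apply] at h
      rcases e : Turing.TM0.step M.trans (M.toCfg c) with _ | c'
      -- A machine that has already halted cannot make the remaining `n + 1` steps.
      · exfalso
        have : ∀ n, (flip bind (Turing.TM0.step M.trans))^[n] none = none := by
          intro n
          induction n with
          | zero => rfl
          | succ n ih => rw [Function.iterate_succ_apply]; exact ih
        simp only [flip, Option.bind_eq_bind, Option.bind_some, e] at h
        exact absurd ((this n).symm.trans h) (by simp)
      · rw [toCfg_listStep, e]
        simpa [flip, e] using h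

/-- The tape from the head rightwards, `t` steps after the start on the program `p`. -/
def output (t : ℕ) (p : List Bool) : List (Fin (M.extraSymbols + 4)) :=
  (M.listStep^[t] ((0, [], M.word p) : M.ListCfg)).2.2

/-- The tape symbol of a bit. -/
def bit (b : Bool) : Fin (M.extraSymbols + 4) := if b then 2 else 1

theorem bit_injective : Function.Injective M.bit := by
  intro a b
  have h : 2 % (M.extraSymbols + 4) = 2 := Nat.mod_eq_of_lt (by omega)
  cases a <;> cases b <;> simp [bit, Fin.ext_iff, h]

theorem OutputsWithin.getI_output {M : Machine} {t : ℕ} {p x : List Bool}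
    (h : M.OutputsWithin t p x) {i : ℕ} (hi : i < x.length) :
    (M.output t p).getI i = M.bit x[i] := by
  obtain ⟨c, ⟨⟨⟨n, hn⟩, hnt⟩⟩, hc, hx⟩ := h
  have h1 := M.toCfg_iterate_listStep (0, [], M.word p) n t hnt c hc hn
  have h2 := hx i (by simp [word]; omega)
  have h3 : c.Tape.right₀.nth i = (M.output t p).getI i := by
    rw [← h1, toCfg, Turing.Tape.mk'_right₀, Turing.ListBlank.nth_mk]
    rfl
  rw [← h3, h2]
  simp [word, bit, List.getElem_append_left, hi]

theorem primrec_word : Primrec M.word :=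
  Primrec.list_append.comp
    (Primrec.list_map Primrec.id ((Primrec.dom_finite M.bit).comp Primrec.snd).to₂)
    (Primrec.const [3])

theorem primrec_listStep : Primrec M.listStep := by
  have h : Primrec fun c : M.ListCfg => (c.1, c.2.2.headI) :=
    Primrec.fst.pair (Primrec.list_headI.comp (Primrec.snd.comp Primrec.snd))
  have hl : Primrec fun c : M.ListCfg => c.2.1 := Primrec.fst.comp Primrec.snd
  have hr : Primrec fun c : M.ListCfg => c.2.2 := Primrec.snd.comp Primrec.snd
  have hk := (Primrec.dom_finite M.actKind).comp h
  have hs := (Primrec.dom_finite M.actState).comp h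
  have ha := (Primrec.dom_finite M.actSymbol).comp h
  exact Primrec.ite (Primrec.eq.comp hk (Primrec.const 0)) Primrec.id <|
    Primrec.ite (Primrec.eq.comp hk (Primrec.const 1))
      (hs.pair ((Primrec.list_tail.comp hl).pair
        (Primrec.list_cons.comp (Primrec.list_headI.comp hl) hr))) <|
    Primrec.ite (Primrec.eq.comp hk (Primrec.const 2))
      (hs.pair ((Primrec.list_cons.comp (Primrec.list_headI.comp hr) hl).pair
        (Primrec.list_tail.comp hr))) <|
    hs.pair (hl.pair (Primrec.list_cons.comp ha (Primrec.list_tail.comp hr)))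

theorem primrec_output : Primrec₂ M.output :=
  Primrec.snd.comp <| Primrec.snd.comp <| Primrec.nat_iterate Primrec.fst
    ((Primrec.const 0).pair ((Primrec.const []).pair (M.primrec_word.comp Primrec.snd)))
    (M.primrec_listStep.comp Primrec.snd).to₂

end Machine

/-! ### Primitive recursiveness of the hierarchical words -/

section Primrec

variable {α β : Type*} [Primcodable α] [Primcodable β]

theorem primrecPred_exists_lt {f : α → ℕ} {R : α → ℕ → Prop} (hf : Primrec f)
    (hR : PrimrecRel R) : PrimrecPred fun a => ∃ x < f a, R a x :=
  ((PrimrecRel.exists_mem_list (R := fun x a => R a x)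
    (hR.comp Primrec.snd Primrec.fst)).comp (Primrec.list_range.comp hf) Primrec.id).of_eq
    (by simp)

theorem primrecPred_forall_lt {f : α → ℕ} {R : α → ℕ → Prop} (hf : Primrec f)
    (hR : PrimrecRel R) : PrimrecPred fun a => ∀ x < f a, R a x :=
  ((PrimrecRel.forall_mem_list (R := fun x a => R a x)
    (hR.comp Primrec.snd Primrec.fst)).comp (Primrec.list_range.comp hf) Primrec.id).of_eq
    (by simp)

theorem primrecPred_exists_mem {f : α → List β} {R : α → β → Prop} (hf : Primrec f)
    (hR : PrimrecRel R) : PrimrecPred fun a => ∃ x ∈ f a, R a x :=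
  (PrimrecRel.exists_mem_list (R := fun x a => R a x)
    (hR.comp Primrec.snd Primrec.fst)).comp hf Primrec.id

theorem primrecPred_forall_mem {f : α → List β} {R : α → β → Prop} (hf : Primrec f)
    (hR : PrimrecRel R) : PrimrecPred fun a => ∀ x ∈ f a, R a x :=
  (PrimrecRel.forall_mem_list (R := fun x a => R a x)
    (hR.comp Primrec.snd Primrec.fst)).comp hf Primrec.id

theorem primrecPred_exists_finite [Finite β] {R : α → β → Prop} (hR : PrimrecRel R) :
    PrimrecPred fun a => ∃ x, R a x := by
  have := Fintype.ofFinite β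
  exact (primrecPred_exists_mem (Primrec.const (Finset.univ : Finset β).toList) hR).of_eq
    (by simp)

theorem primrecPred_forall_finite [Finite β] {R : α → β → Prop} (hR : PrimrecRel R) :
    PrimrecPred fun a => ∀ x, R a x := by
  have := Fintype.ofFinite β
  exact (primrecPred_forall_mem (Primrec.const (Finset.univ : Finset β).toList) hR).of_eq
    (by simp)

end Primrec

theorem primrec_pow (n : ℕ) : Primrec fun a : ℕ => a ^ n := by
  induction n with
  | zero => exact Primrec.const 1
  | succ n ih => exact Primrec.nat_mul.comp ih Primrec.id

theorem primrec_side : Primrec side := by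
  refine (Primrec.nat_rec₁ 1 (f := fun _ s => 8 * s ^ 4) ?_).of_eq fun k => ?_
  · exact Primrec.nat_mul.comp (Primrec.const 8) ((primrec_pow 4).comp Primrec.snd)
  · induction k with
    | zero => rfl
    | succ k ih => simp only [side, ← ih]

theorem primrec_ratio : Primrec ratio :=
  Primrec.nat_mul.comp (Primrec.const 8) ((primrec_pow 3).comp primrec_side)

theorem primrec_patch : Primrec₂ patch :=
  (Primrec.list_getD false).comp (Primrec.const _)
    (Primrec.nat_add.comp (Primrec.nat_mul.comp (Primrec.const 5) Primrec.fst) Primrec.snd)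

theorem primrec_entry :
    Primrec fun a : (List Bool × ℕ) × ℕ × ℕ => entry a.1.1 a.1.2 a.2.1 a.2.2 := by
  have hi : Primrec fun a : (List Bool × ℕ) × ℕ × ℕ => a.2.1 := Primrec.fst.comp Primrec.snd
  have hj : Primrec fun a : (List Bool × ℕ) × ℕ × ℕ => a.2.2 := Primrec.snd.comp Primrec.snd
  exact Primrec.ite (Primrec.nat_lt.comp hi (Primrec.const 8)) (primrec_patch.comp hi hj)
    ((Primrec.list_getD false).comp (Primrec.fst.comp Primrec.fst)
      (Primrec.nat_add.comp (Primrec.nat_mul.comp (Primrec.nat_sub.comp hi (Primrec.const 8))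
        (Primrec.snd.comp Primrec.fst)) hj))

/-- The sequence of words with the given initial part. -/
def wordsOf (l : List (List Bool)) (m : ℕ) : List Bool := l.getD m []

theorem primrec_letter :
    Primrec fun a : (List (List Bool) × ℕ) × ℕ × ℕ =>
      letter (wordsOf a.1.1) a.1.2 a.2.1 a.2.2 := by
  have hm : Primrec fun p : (List (List Bool) × ℕ × ℕ) × ℕ × Bool => p.2.1 :=
    Primrec.fst.comp Primrec.snd
  have hd {f : (List (List Bool) × ℕ × ℕ) × ℕ × Bool → ℕ} (hf : Primrec f) :
      Primrec fun p => f p / side p.2.1 % ratio p.2.1 :=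
    Primrec.nat_mod.comp (Primrec.nat_div.comp hf (primrec_side.comp hm))
      (primrec_ratio.comp hm)
  have h := (Primrec.nat_rec (α := List (List Bool) × ℕ × ℕ) (f := fun _ => false)
    (g := fun a p => p.2 ^^ entry (wordsOf a.1 p.1) (ratio p.1)
      (a.2.1 / side p.1 % ratio p.1) (a.2.2 / side p.1 % ratio p.1))
    (Primrec.const false) ((Primrec.dom_bool₂ xor).comp (Primrec.snd.comp Primrec.snd)
      (primrec_entry.comp
        ((((Primrec.list_getD []).comp (Primrec.fst.comp Primrec.fst) hm).pair
          (primrec_ratio.comp hm)).pair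
        ((hd (Primrec.fst.comp (Primrec.snd.comp Primrec.fst))).pair
          (hd (Primrec.snd.comp (Primrec.snd.comp Primrec.fst)))))))).comp
    (((Primrec.fst.comp Primrec.fst).pair Primrec.snd) :
      Primrec fun a : (List (List Bool) × ℕ) × ℕ × ℕ => (a.1.1, a.2))
    (Primrec.snd.comp Primrec.fst)
  refine h.of_eq ?_
  rintro ⟨⟨l, k⟩, i, j⟩
  dsimp only
  induction k with
  | zero => rfl
  | succ k ih => simp only [letter, ← ih]

/-! ### Enumeration of binary strings. -/

/-- All binary strings of length `n`. -/
def strings : ℕ → List (List Bool)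
  | 0 => [[]]
  | n + 1 => (strings n).flatMap fun p => [false :: p, true :: p]

theorem mem_strings {n : ℕ} {p : List Bool} : p ∈ strings n ↔ p.length = n := by
  induction n generalizing p with
  | zero => simp [strings]
  | succ n ih =>
    rcases p with _ | ⟨_ | _, p⟩ <;> simp [strings, ih]

theorem length_strings (n : ℕ) : (strings n).length = 2 ^ n := by
  induction n with
  | zero => rfl
  | succ n ih => simp [strings, List.length_flatMap, ih, pow_succ]

theorem primrec_strings : Primrec strings := by
  refine (Primrec.nat_rec₁ [[]]
    (f := fun _ l => l.flatMap fun p => [false :: p, true :: p]) ?_).of_eq fun k => ?_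
  · have hc (b : Bool) : Primrec fun a : (ℕ × List (List Bool)) × List Bool => b :: a.2 :=
      Primrec.list_cons.comp (Primrec.const b) Primrec.snd
    exact Primrec.list_flatMap Primrec.snd
      (Primrec.list_cons.comp (hc false) (Primrec.list_cons.comp (hc true) (Primrec.const [])))
  · induction k with
    | zero => rfl
    | succ k ih => simp only [strings, ← ih]

/-! ### Words avoiding the outputs of short programs -/

/-- All binary strings of length less than `m`. -/
def shortStrings (m : ℕ) : List (List Bool) := (List.range m).flatMap strings

theorem mem_shortStrings {m : ℕ} {p : List Bool} : p ∈ shortStrings m ↔ p.length < m := by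
  simp [shortStrings, mem_strings]

theorem length_shortStrings (m : ℕ) : (shortStrings m).length < 2 ^ m := by
  have h : (shortStrings m).length = ∑ i ∈ Finset.range m, 2 ^ i := by
    simp [shortStrings, List.length_flatMap, length_strings, Finset.sum_range,
      ← List.sum_ofFn, List.ofFn_eq_map, ← List.map_coe_finRange_eq_range]
    rfl
  have := Nat.geomSum_eq (m := 2) le_rfl m
  have := Nat.two_pow_pos m
  omega

theorem primrec_shortStrings : Primrec shortStrings :=
  Primrec.list_flatMap Primrec.list_range (primrec_strings.comp Primrec.snd).to₂

variable (M : Machine)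

/-- After `t` steps on the program `p` the tape holds an array of side `2 * side k` that contains
at `(i, j)` the block of level `k` or its complement. -/
def ProducesBlock (l : List (List Bool)) (k t : ℕ) (p : List Bool) (i j : ℕ) (b : Bool) : Prop :=
  ∀ r < side k, ∀ s < side k, (M.output t p).getI ((i + r) * (2 * side k) + (j + s)) =
    M.bit (b ^^ letter (wordsOf l) k r s)

/-- A short program produces in time `t` a pattern containing the last block. -/
def IsSimple (l : List (List Bool)) (k t m : ℕ) : Prop :=
  ∃ p ∈ shortStrings m, ∃ i < side k, ∃ j < side k, ∃ b, ProducesBlock M l k t p i j b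

/-- All quantifiers are bounded, and the running time is an argument; thus the time function enters
the choice of the words only through its values. -/
theorem primrecPred_isSimple : PrimrecPred fun a : List (List Bool) × ℕ × ℕ × ℕ =>
    IsSimple M a.1 a.2.1 a.2.2.1 a.2.2.2 := by
  let A := List (List Bool) × ℕ × ℕ × ℕ
  have hk : Primrec fun a : A => side a.2.1 :=
    primrec_side.comp (Primrec.fst.comp Primrec.snd)
  refine primrecPred_exists_mem (primrec_shortStrings.comp
    (Primrec.snd.comp (Primrec.snd.comp Primrec.snd))) ?_
  refine primrecPred_exists_lt (α := A × List Bool) (hk.comp Primrec.fst) ?_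
  refine primrecPred_exists_lt (α := (A × List Bool) × ℕ)
    (hk.comp (Primrec.fst.comp Primrec.fst)) ?_
  refine primrecPred_exists_finite (α := ((A × List Bool) × ℕ) × ℕ) ?_
  refine primrecPred_forall_lt (α := (((A × List Bool) × ℕ) × ℕ) × Bool)
    (hk.comp (Primrec.fst.comp (Primrec.fst.comp (Primrec.fst.comp Primrec.fst)))) ?_
  refine primrecPred_forall_lt (α := ((((A × List Bool) × ℕ) × ℕ) × Bool) × ℕ)
    (hk.comp (Primrec.fst.comp (Primrec.fst.comp (Primrec.fst.comp
      (Primrec.fst.comp Primrec.fst))))) ?_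
  let B := (((((A × List Bool) × ℕ) × ℕ) × Bool) × ℕ) × ℕ
  have hs : Primrec fun a : B => a.2 := Primrec.snd
  have hr : Primrec fun a : B => a.1.2 := Primrec.snd.comp Primrec.fst
  have h1 : Primrec fun a : B => a.1.1 := Primrec.fst.comp Primrec.fst
  have hb : Primrec fun a : B => a.1.1.2 := Primrec.snd.comp h1
  have hj : Primrec fun a : B => a.1.1.1.2 := Primrec.snd.comp (Primrec.fst.comp h1)
  have h2 : Primrec fun a : B => a.1.1.1.1 := Primrec.fst.comp (Primrec.fst.comp h1)
  have hi : Primrec fun a : B => a.1.1.1.1.2 := Primrec.snd.comp h2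
  have hp : Primrec fun a : B => a.1.1.1.1.1.2 := Primrec.snd.comp (Primrec.fst.comp h2)
  have hA : Primrec fun a : B => a.1.1.1.1.1.1 := Primrec.fst.comp (Primrec.fst.comp h2)
  have hidx : Primrec fun a : B => (a.1.1.1.1.2 + a.1.2) * (2 * side a.1.1.1.1.1.1.2.1) +
      (a.1.1.1.2 + a.2) :=
    Primrec.nat_add.comp (Primrec.nat_mul.comp (Primrec.nat_add.comp hi hr)
      (Primrec.nat_mul.comp (Primrec.const 2) (hk.comp hA))) (Primrec.nat_add.comp hj hs)
  have hout := M.primrec_output.comp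
    ((Primrec.fst.comp (Primrec.snd.comp Primrec.snd)).comp hA) hp
  have hlet := primrec_letter.comp (((Primrec.fst.comp hA).pair
    ((Primrec.fst.comp Primrec.snd).comp hA)).pair (hr.pair hs))
  exact Primrec.eq.comp (Primrec.list_getI.comp hout hidx)
    ((Primrec.dom_finite M.bit).comp ((Primrec.dom_bool₂ xor).comp hb hlet))

/-- The programs shorter than this bound are considered in the choice of the word of level `k`. -/
def bound (k : ℕ) : ℕ := 32 * side k ^ 6

/-- Length of the word of level `k`. -/
def wordLength (k : ℕ) : ℕ := (ratio k - 8) * ratio k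

open scoped Classical in
/-- The first word that makes the next block hard to produce in time `t`. -/
def nextWord (l : List (List Bool)) (t : ℕ) : List Bool :=
  (strings (wordLength l.length)).getD ((strings (wordLength l.length)).findIdx fun w =>
    decide (¬ IsSimple M (l ++ [w]) (l.length + 1) t (bound l.length))) []

/-- The words of levels less than `k`. -/
def prefixWords (T : ℕ → ℕ) : ℕ → List (List Bool)
  | 0 => []
  | k + 1 => prefixWords T k ++ [nextWord M (prefixWords T k) (T (2 * side (k + 1)))]

/-- The word of level `k`. -/
def words (T : ℕ → ℕ) (k : ℕ) : List Bool :=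
  nextWord M (prefixWords M T k) (T (2 * side (k + 1)))

theorem length_prefixWords (T : ℕ → ℕ) (k : ℕ) : (prefixWords M T k).length = k := by
  induction k with
  | zero => rfl
  | succ k ih => simp [prefixWords, ih]

theorem wordsOf_prefixWords (T : ℕ → ℕ) {m k : ℕ} (h : m < k) :
    wordsOf (prefixWords M T k) m = words M T m := by
  induction k, h using Nat.le_induction with
  | base => simp [wordsOf, prefixWords, length_prefixWords, words]
  | succ k hk ih =>
    rw [wordsOf, prefixWords, List.getD_append _ _ _ _ (by rw [length_prefixWords]; omega)]
    exact ih

theorem primrec_bound : Primrec bound :=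
  Primrec.nat_mul.comp (Primrec.const 32) ((primrec_pow 6).comp primrec_side)

theorem primrec_wordLength : Primrec wordLength :=
  Primrec.nat_mul.comp (Primrec.nat_sub.comp primrec_ratio (Primrec.const 8)) primrec_ratio

theorem primrec_nextWord : Primrec₂ (nextWord M) := by
  have hs : Primrec fun a : List (List Bool) × ℕ => strings (wordLength a.1.length) :=
    primrec_strings.comp (primrec_wordLength.comp (Primrec.list_length.comp Primrec.fst))
  refine (Primrec.list_getD []).comp hs (Primrec.list_findIdx hs ?_)
  have hl : Primrec fun a : (List (List Bool) × ℕ) × List Bool => a.1.1 :=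
    Primrec.fst.comp Primrec.fst
  have h := ((primrecPred_isSimple M).comp
    (((Primrec.list_concat.comp hl Primrec.snd).pair
      ((Primrec.succ.comp (Primrec.list_length.comp hl)).pair
        ((Primrec.snd.comp Primrec.fst).pair
          (primrec_bound.comp (Primrec.list_length.comp hl))))) :
      Primrec fun a : (List (List Bool) × ℕ) × List Bool =>
        (a.1.1 ++ [a.2], a.1.1.length + 1, a.1.2, bound a.1.1.length))).not
  classical exact h.decide

theorem computable_prefixWords {T : ℕ → ℕ} (hT : Computable T) :
    Computable (prefixWords M T) := by
  have hk : Computable fun a : ℕ × ℕ × List (List Bool) => a.2.1 :=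
    Computable.fst.comp Computable.snd
  have hl : Computable fun a : ℕ × ℕ × List (List Bool) => a.2.2 :=
    Computable.snd.comp Computable.snd
  have hside : Primrec fun k => 2 * side (k + 1) :=
    Primrec.nat_mul.comp (Primrec.const 2) (primrec_side.comp Primrec.succ)
  refine (Computable.nat_rec Computable.id (Computable.const [])
    (h := fun _ (a : ℕ × List (List Bool)) =>
      a.2 ++ [nextWord M a.2 (T (2 * side (a.1 + 1)))]) ?_).of_eq fun k => ?_
  · exact Computable.list_concat.comp hl ((primrec_nextWord M).to_comp.comp hl
      (hT.comp (hside.to_comp.comp hk)))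
  · dsimp only [id]
    induction k with
    | zero => rfl
    | succ k ih => simp only [prefixWords, ← ih]

/-! ### Hardness of the blocks -/

theorem eq_of_entry_eq {N : ℕ} (hN : 8 ≤ N) {w w' : List Bool}
    (hw : w.length = (N - 8) * N) (hw' : w'.length = (N - 8) * N)
    (h : ∀ i < N, ∀ j < N, entry w N i j = entry w' N i j) : w = w' := by
  refine List.ext_getElem (hw.trans hw'.symm) fun n h1 h2 => ?_
  rw [hw] at h1
  have hd : n / N < N - 8 := Nat.div_lt_of_lt_mul (by rwa [mul_comm])
  have := h (n / N + 8) (by omega) (n % N) (Nat.mod_lt _ (by omega))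
  simp only [entry, if_neg (Nat.not_lt.2 (Nat.le_add_left 8 (n / N))), Nat.add_sub_cancel,
    Nat.div_add_mod'] at this
  rwa [List.getD_eq_getElem _ _ (by omega), List.getD_eq_getElem _ _ (by omega)] at this

/-- One letter is read at the corner of each subblock. The lower levels are the same for both words
and cancel, as does the sign `b`, so the two arrays of entries agree. -/
theorem eq_of_producesBlock {l : List (List Bool)} {w w' : List Bool} {t i j : ℕ}
    {p : List Bool} {b : Bool}
    (hw : w.length = wordLength l.length) (hw' : w'.length = wordLength l.length)
    (h : ProducesBlock M (l ++ [w]) (l.length + 1) t p i j b)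
    (h' : ProducesBlock M (l ++ [w']) (l.length + 1) t p i j b) : w = w' := by
  refine eq_of_entry_eq (eight_le_ratio l.length) hw hw' fun m hm n hn => ?_
  have lt {m : ℕ} (hm : m < ratio l.length) : side l.length * m < side (l.length + 1) := by
    rw [side_succ]; exact Nat.mul_lt_mul_of_pos_left hm (side_pos _)
  have e := M.bit_injective ((h _ (lt hm) _ (lt hn)).symm.trans (h' _ (lt hm) _ (lt hn)))
  have hl (v : List Bool) : wordsOf (l ++ [v]) l.length = v := by
    simp [wordsOf]
  rw [letter, letter, hl, hl, letter_congr (w := wordsOf (l ++ [w])) (w' := wordsOf (l ++ [w']))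
    fun m hm => by rw [wordsOf, wordsOf, List.getD_append _ _ _ _ hm, List.getD_append _ _ _ _ hm]]
    at e
  simpa [Nat.mul_div_right _ (side_pos _), Nat.mod_eq_of_lt hm, Nat.mod_eq_of_lt hn] using e

/-- Otherwise each word would be assigned a program, an offset and a sign, and these determine the
word. There are fewer than `2 ^ m` programs, so there are too few triples. -/
theorem exists_not_isSimple (l : List (List Bool)) (t m : ℕ)
    (hm : 2 ^ m * (side (l.length + 1) * side (l.length + 1) * 2) ≤ 2 ^ wordLength l.length) :
    ∃ w ∈ strings (wordLength l.length), ¬ IsSimple M (l ++ [w]) (l.length + 1) t m := by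
  by_contra! H
  have H' (w : List.Vector Bool (wordLength l.length)) := H w.1 (mem_strings.2 w.2)
  choose p hp i hi j hj b h using H'
  let S := (shortStrings m).toFinset ×ˢ (Finset.range (side (l.length + 1)) ×ˢ
    Finset.range (side (l.length + 1))) ×ˢ (Finset.univ : Finset Bool)
  have hS : S.card < (Finset.univ : Finset (List.Vector Bool (wordLength l.length))).card := by
    rw [Finset.card_univ, card_vector, Fintype.card_bool]
    simp only [S, Finset.card_product, Finset.card_range, Finset.card_univ, Fintype.card_bool]
    refine lt_of_lt_of_le (Nat.mul_lt_mul_of_pos_right ?_ ?_) hm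
    · exact (List.toFinset_card_le _).trans_lt (length_shortStrings m)
    · have := side_pos (l.length + 1)
      positivity
  obtain ⟨w, -, w', -, hne, he⟩ := Finset.exists_ne_map_eq_of_card_lt_of_maps_to hS
    (f := fun w => (p w, (i w, j w), b w)) (fun w _ => by simp [S, hp w, hi w, hj w])
  simp only [Prod.mk.injEq] at he
  obtain ⟨e1, ⟨e2, e3⟩, e4⟩ := he
  have h' := h w'
  rw [← e1, ← e2, ← e3, ← e4] at h'
  exact hne (Subtype.ext (eq_of_producesBlock M w.2 w'.2 (h w) h'))

/-- The word has `64 * L ^ 6 - 64 * L ^ 3` bits, where `L = side k`, twice `bound k` up to lower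
order; the surplus pays for the offsets and the sign. Level `0` must be excluded: `ratio 0 = 8`
leaves no free entries. -/
theorem two_pow_bound_mul_le {k : ℕ} (hk : 1 ≤ k) :
    2 ^ bound k * (side (k + 1) * side (k + 1) * 2) ≤ 2 ^ wordLength k := by
  have h1 : side (k + 1) ≤ 2 ^ side (k + 1) := Nat.lt_two_pow_self.le
  have h2 : 8 ≤ side k := by simpa [side] using side_strictMono.monotone hk
  have h3 : bound k + (side (k + 1) + side (k + 1) + 1) ≤ wordLength k := by
    obtain ⟨d, hd⟩ : ∃ d, side k ^ 3 = d + 1 :=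
      ⟨side k ^ 3 - 1, by have := pow_pos (side_pos k) 3; omega⟩
    have e1 : wordLength k = 64 * side k ^ 6 - 64 * side k ^ 3 := by
      simp only [wordLength, ratio, Nat.sub_mul]
      congr 1 <;> ring
    have e2 : 64 * side k ^ 4 ≤ side k ^ 6 := by
      have : 64 ≤ side k ^ 2 := by nlinarith
      calc 64 * side k ^ 4 ≤ side k ^ 2 * side k ^ 4 := Nat.mul_le_mul_right _ this
        _ = _ := by ring
    have e3 : 8 * side k ^ 3 ≤ side k ^ 4 := by nlinarith [pow_pos (side_pos k) 3]
    have e4 := pow_pos (side_pos k) 3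
    rw [e1, bound, side]
    omega
  calc 2 ^ bound k * (side (k + 1) * side (k + 1) * 2)
      ≤ 2 ^ bound k * (2 ^ side (k + 1) * 2 ^ side (k + 1) * 2) := by gcongr
    _ = 2 ^ (bound k + (side (k + 1) + side (k + 1) + 1)) := by ring
    _ ≤ _ := Nat.pow_le_pow_right (by norm_num) h3

theorem not_isSimple_prefixWords (T : ℕ → ℕ) {k : ℕ} (hk : 1 ≤ k) :
    ¬ IsSimple M (prefixWords M T (k + 1)) (k + 1) (T (2 * side (k + 1))) (bound k) := by
  classical
  have hl := length_prefixWords M T k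
  obtain ⟨w, hw, h⟩ := exists_not_isSimple M (prefixWords M T k) (T (2 * side (k + 1))) (bound k)
    (by rw [hl]; exact two_pow_bound_mul_le hk)
  rw [hl] at hw h
  have hlt := List.findIdx_lt_length_of_exists (xs := strings (wordLength k)) (p := fun w =>
    decide (¬ IsSimple M (prefixWords M T k ++ [w]) (k + 1) (T (2 * side (k + 1))) (bound k)))
    ⟨w, hw, by simpa using h⟩
  have := List.findIdx_getElem (w := hlt)
  rw [prefixWords, nextWord, hl, List.getD_eq_getElem _ _ (by convert hlt)]
  convert of_decide_eq_true this

/-! ### Codes of square patterns and the lower bound on complexity. -/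

theorem code_eq_ofFn {n : ℕ} (P : Fin n → Fin n → Bool) :
    code P = List.ofFn fun i : Fin (n * n) => P i.divNat i.modNat := by
  rw [List.ofFn_mul, code]
  congr 2
  ext1 i
  congr 1
  ext1 j
  have := j.2
  congr 1 <;> ext
  · simp only [Fin.coe_divNat]
    rw [mul_comm, Nat.mul_add_div (by omega), Nat.div_eq_of_lt this, add_zero]
  · simp only [Fin.coe_modNat]
    rw [Nat.mul_add_mod', Nat.mod_eq_of_lt this]

theorem length_code {n : ℕ} (P : Fin n → Fin n → Bool) : (code P).length = n * n := by
  rw [code_eq_ofFn, List.length_ofFn]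

theorem getElem_code {n : ℕ} (P : Fin n → Fin n → Bool) {i j : ℕ} (hi : i < n) (hj : j < n)
    (h : i * n + j < (code P).length) : (code P)[i * n + j] = P ⟨i, hi⟩ ⟨j, hj⟩ := by
  simp only [code_eq_ofFn, List.getElem_ofFn]
  congr 1 <;> ext
  · simp only [Fin.coe_divNat]
    rw [mul_comm, Nat.mul_add_div (by omega), Nat.div_eq_of_lt hj, add_zero]
  · simp only [Fin.coe_modNat]
    rw [Nat.mul_add_mod', Nat.mod_eq_of_lt hj]

theorem bound_le_complexity (T : ℕ → ℕ) {k : ℕ} (hk : 1 ≤ k)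
    (P : Fin (2 * side (k + 1)) → Fin (2 * side (k + 1)) → Bool)
    (hP : GloballyAdmissible (blockShift (words M T)) P) :
    (bound k : ℕ∞) ≤ M.complexity (T (2 * side (k + 1))) (code P) := by
  refine le_iInf₂ fun p hp => ?_
  by_contra! hlt
  obtain ⟨x, hx, v, hv⟩ := hP
  -- The side `2 * side (k + 1)` is chosen so that the pattern contains a whole aligned block of
  -- level `k + 1`; a short program for the pattern would then make that block simple.
  obtain ⟨i, hi, j, hj, b, hb⟩ := (hx (k + 2)).exists_block v
  refine not_isSimple_prefixWords M T hk ⟨p, mem_shortStrings.2 (by exact_mod_cast hlt), i, hi, j,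
    hj, b, fun r hr s hs => ?_⟩
  have hidx : (i + r) * (2 * side (k + 1)) + (j + s) < (code P).length := by
    rw [length_code]; nlinarith
  rw [Machine.OutputsWithin.getI_output hp hidx]
  congr 1
  rw [letter_congr fun m hm => wordsOf_prefixWords M T hm, ← hb r hr s hs]
  rw [getElem_code P (by omega) (by omega)]
  exact (hv ⟨i + r, by omega⟩ ⟨j + s, by omega⟩).symm

/-! ### Effectiveness -/

theorem encode_natCast (n : ℕ) : Encodable.encode (n : ℤ) = 2 * n := rfl

theorem encode_negSucc (n : ℕ) : Encodable.encode (Int.negSucc n) = 2 * n + 1 := rfl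

/-- The sign of an integer is the parity of its code. -/
theorem primrecPred_int_nonneg : PrimrecPred fun z : ℤ => 0 ≤ z := by
  refine (Primrec.eq.comp (Primrec.nat_mod.comp Primrec.encode (Primrec.const 2))
    (Primrec.const 0)).of_eq fun z => ?_
  cases z with
  | ofNat n => simp [encode_natCast]
  | negSucc n => simp [encode_negSucc, Nat.add_mod]

theorem primrec_int_toNat : Primrec Int.toNat := by
  refine (Primrec.ite primrecPred_int_nonneg
    (Primrec.nat_div.comp Primrec.encode (Primrec.const 2)) (Primrec.const 0)).of_eq fun z => ?_
  cases z with
  | ofNat n => simp [encode_natCast]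
  | negSucc n => simp

theorem primrec_sel : Primrec fun a : (Bool × Bool × Bool × Bool) × Bool × Bool =>
    sel a.1 a.2.1 a.2.2 :=
  Primrec.dom_finite _

theorem primrec_combo : Primrec fun a : (List (List Bool) × ℕ × ℕ × ℕ ×
    (Bool × Bool × Bool × Bool)) × ℕ × ℕ =>
      combo (wordsOf a.1.1) a.1.2.1 a.1.2.2.1 a.1.2.2.2.1 a.1.2.2.2.2 a.2.1 a.2.2 := by
  let A := (List (List Bool) × ℕ × ℕ × ℕ × (Bool × Bool × Bool × Bool)) × ℕ × ℕ
  have h1 : Primrec fun a : A => a.1.2 := Primrec.snd.comp Primrec.fst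
  have h2 : Primrec fun a : A => a.1.2.2 := Primrec.snd.comp h1
  have h3 : Primrec fun a : A => a.1.2.2.2 := Primrec.snd.comp h2
  have hk : Primrec fun a : A => a.1.2.1 := Primrec.fst.comp h1
  have hi : Primrec fun a : A => a.1.2.2.1 + a.2.1 :=
    Primrec.nat_add.comp (Primrec.fst.comp h2) (Primrec.fst.comp Primrec.snd)
  have hj : Primrec fun a : A => a.1.2.2.2.1 + a.2.2 :=
    Primrec.nat_add.comp (Primrec.fst.comp h3) (Primrec.snd.comp Primrec.snd)
  have hside := primrec_side.comp hk
  exact (Primrec.dom_bool₂ xor).comp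
    (primrec_sel.comp ((Primrec.snd.comp h3).pair
      ((Primrec.nat_le.comp hside hi).decide.pair (Primrec.nat_le.comp hside hj).decide)))
    (primrec_letter.comp (((Primrec.fst.comp Primrec.fst).pair hk).pair (hi.pair hj)))

theorem combo_congr {w w' : ℕ → List Bool} {k : ℕ} (h : ∀ m < k, w m = w' m) (i j : ℕ)
    (q : Bool × Bool × Bool × Bool) (r s : ℕ) : combo w k i j q r s = combo w' k i j q r s := by
  rw [combo, combo, letter_congr h]

/-- The cell lies in the window `[0, L) × [0, L)`. -/
def InWindow (L : ℕ) (u : ℤ × ℤ) : Prop :=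
  (0 ≤ u.1 ∧ u.1.toNat < L) ∧ (0 ≤ u.2 ∧ u.2.toNat < L)

/-- The pattern lies in a window with the side of level `k`, and it does not occur there in a
`2 × 2` array of blocks of level `k`. -/
def Clashes (w : ℕ → List Bool) (p : List ((ℤ × ℤ) × Bool)) (k : ℕ) : Prop :=
  (∀ e ∈ p, InWindow (side k) e.1) ∧ ∀ i < side k, ∀ j < side k, ∀ q, ∃ e ∈ p,
    e.2 ≠ combo w k i j q e.1.1.toNat e.1.2.toNat

theorem clashes_congr {w w' : ℕ → List Bool} {k : ℕ} (h : ∀ m < k, w m = w' m)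
    (p : List ((ℤ × ℤ) × Bool)) : Clashes w p k ↔ Clashes w' p k := by
  simp only [Clashes, combo_congr h]

theorem primrecPred_clashes :
    PrimrecPred fun a : (List (List Bool) × List ((ℤ × ℤ) × Bool)) × ℕ =>
      Clashes (wordsOf a.1.1) a.1.2 a.2 := by
  let A := (List (List Bool) × List ((ℤ × ℤ) × Bool)) × ℕ
  have hside : Primrec fun a : A => side a.2 := primrec_side.comp Primrec.snd
  have hp : Primrec fun a : A => a.1.2 := Primrec.snd.comp Primrec.fst
  refine .and (primrecPred_forall_mem hp ?_) ?_
  · have hz {f : A × (ℤ × ℤ) × Bool → ℤ} (hf : Primrec f) :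
        PrimrecPred fun a => 0 ≤ f a ∧ (f a).toNat < side a.1.2 :=
      (primrecPred_int_nonneg.comp hf).and
        (Primrec.nat_lt.comp (primrec_int_toNat.comp hf) (hside.comp Primrec.fst))
    exact (hz (Primrec.fst.comp (Primrec.fst.comp Primrec.snd))).and
      (hz (Primrec.snd.comp (Primrec.fst.comp Primrec.snd)))
  refine primrecPred_forall_lt hside ?_
  refine primrecPred_forall_lt (α := A × ℕ) (hside.comp Primrec.fst) ?_
  refine primrecPred_forall_finite (α := (A × ℕ) × ℕ) ?_
  refine primrecPred_exists_mem (α := ((A × ℕ) × ℕ) × (Bool × Bool × Bool × Bool))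
    (hp.comp (Primrec.fst.comp (Primrec.fst.comp Primrec.fst))) ?_
  let B := (((A × ℕ) × ℕ) × (Bool × Bool × Bool × Bool)) × (ℤ × ℤ) × Bool
  have hq : Primrec fun a : B => a.1.2 := Primrec.snd.comp Primrec.fst
  have h1 : Primrec fun a : B => a.1.1 := Primrec.fst.comp Primrec.fst
  have hj : Primrec fun a : B => a.1.1.2 := Primrec.snd.comp h1
  have hi : Primrec fun a : B => a.1.1.1.2 := Primrec.snd.comp (Primrec.fst.comp h1)
  have hA : Primrec fun a : B => a.1.1.1.1 := Primrec.fst.comp (Primrec.fst.comp h1)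
  have hu : Primrec fun a : B => a.2.1 := Primrec.fst.comp Primrec.snd
  exact (Primrec.eq.comp (Primrec.snd.comp Primrec.snd) (primrec_combo.comp
    (((Primrec.fst.comp (Primrec.fst.comp hA)).pair ((Primrec.snd.comp hA).pair
      (hi.pair (hj.pair hq)))).pair ((primrec_int_toNat.comp (Primrec.fst.comp hu)).pair
        (primrec_int_toNat.comp (Primrec.snd.comp hu)))))).not

/-- The list of the cells of a window with their letters. -/
def windowList (x : ℤ × ℤ → Bool) (v : ℤ × ℤ) (L : ℕ) : List ((ℤ × ℤ) × Bool) :=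
  ((List.range L).product (List.range L)).map fun c =>
    (((c.1 : ℤ), (c.2 : ℤ)), x (v + ((c.1 : ℤ), (c.2 : ℤ))))

/-- An illegal window, listed with all its letters, is itself a forbidden pattern. It has `side k ^
2 > k` cells, so bounding the level by the length of the pattern loses nothing and makes the
condition decidable. -/
theorem legal_iff_forall_not_clashes (w : ℕ → List Bool) (x : ℤ × ℤ → Bool) :
    (∀ k, Legal w k x) ↔
      ∀ p, (∃ k < p.length + 1, Clashes w p k) → ∀ v, ¬ OccursAt p x v := by
  constructor
  · rintro hx p ⟨k, -, hp, h⟩ v hv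
    obtain ⟨i, hi, j, hj, q, hq⟩ := hx k v
    obtain ⟨e, he, hne⟩ := h i hi j hj q
    obtain ⟨⟨h1, h1'⟩, h2, h2'⟩ := hp e he
    apply hne
    rw [← hq _ h1' _ h2', ← hv e he, Int.toNat_of_nonneg h1, Int.toNat_of_nonneg h2]
  · intro h k v
    by_contra hnot
    refine h (windowList x v (side k)) ⟨k, ?_, ?_, ?_⟩ v ?_
    · have := lt_side k
      have hlen : (windowList x v (side k)).length = side k * side k := by
        rw [windowList, List.length_map]
        exact (List.length_product _ _).trans (by simp)
      rw [hlen]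
      nlinarith
    · intro e he
      simp only [windowList, List.mem_map, Prod.exists, List.pair_mem_product,
        List.mem_range] at he
      obtain ⟨r, s, ⟨hr, hs⟩, rfl⟩ := he
      simp [InWindow, hr, hs]
    · intro i hi j hj q
      by_contra! hall
      refine hnot ⟨i, hi, j, hj, q, fun r hr s hs => ?_⟩
      refine hall (((r : ℤ), (s : ℤ)), x (v + ((r : ℤ), (s : ℤ)))) ?_
      simp only [windowList, List.mem_map, Prod.exists, List.pair_mem_product, List.mem_range]
      exact ⟨r, s, ⟨hr, hs⟩, rfl⟩
    · intro e he
      simp only [windowList, List.mem_map, Prod.exists, List.pair_mem_product,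
        List.mem_range] at he
      obtain ⟨r, s, -, rfl⟩ := he
      rfl

theorem isEffective_blockShift (M : Machine) {T : ℕ → ℕ} (hT : Computable T) :
    IsEffective (blockShift (words M T)) := by
  classical
  refine ⟨fun p => ∃ k < p.length + 1, Clashes (words M T) p k, ?_,
    Set.ext fun x => legal_iff_forall_not_clashes _ x⟩
  have hlen : Primrec fun p : List ((ℤ × ℤ) × Bool) => p.length + 1 :=
    Primrec.succ.comp Primrec.list_length
  have h := (primrecPred_exists_lt (hlen.comp Primrec.snd)
    (R := fun (a : List (List Bool) × List ((ℤ × ℤ) × Bool)) k => Clashes (wordsOf a.1) a.2 k) primrecPred_clashes).decide.to_comp.comp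
    (((computable_prefixWords M hT).comp hlen.to_comp).pair Computable.id)
  refine Computable.computablePred (h.of_eq fun p => decide_eq_decide.2 ?_)
  -- Only levels up to `p.length` are tested, so the first `p.length + 1` words are enough.
  refine exists_congr fun k => and_congr_right fun hk => clashes_congr (fun m hm => ?_) _
  exact wordsOf_prefixWords M T (hm.trans hk)

/-! ### Logarithmic complexity -/

/-- The number with the given binary digits below a leading digit `1`. -/
def numeral (p : List Bool) : ℕ := p.foldr (fun b a => 2 * a + b.toNat) 1

theorem exists_numeral_eq (e : ℕ) (he : 1 ≤ e) : ∃ p, numeral p = e ∧ 2 ^ p.length ≤ e := by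
  induction e using Nat.strong_induction_on with
  | _ e ih =>
    rcases he.eq_or_lt with rfl | h1
    · exact ⟨[], rfl, le_rfl⟩
    obtain ⟨p, hp, hl⟩ := ih (e / 2) (by omega) (by omega)
    refine ⟨decide (e % 2 = 1) :: p, ?_, ?_⟩
    · rw [numeral, List.foldr_cons]
      rw [numeral] at hp
      rw [hp]
      rcases Nat.mod_two_eq_zero_or_one e with h | h <;> simp [h] <;> omega
    · rw [List.length_cons, pow_succ]
      omega

theorem primrec_numeral : Primrec numeral :=
  Primrec.list_foldr Primrec.id (Primrec.const 1)
    (Primrec.nat_add.comp (Primrec.nat_mul.comp (Primrec.const 2)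
      (Primrec.snd.comp Primrec.snd))
      ((Primrec.dom_finite Bool.toNat).comp (Primrec.fst.comp Primrec.snd))).to₂

/-- The code of the `n × n` pattern at `(i, j)` in a `2 × 2` array of blocks of level `k`. -/
def comboCode (w : ℕ → List Bool) (a : ℕ × ℕ × ℕ × ℕ × (Bool × Bool × Bool × Bool)) :
    List Bool :=
  (List.range a.1).flatMap fun r => (List.range a.1).map fun s =>
    combo w a.2.1 a.2.2.1 a.2.2.2.1 a.2.2.2.2 r s

theorem primrec_comboCode : Primrec₂ fun (l : List (List Bool))
    (a : ℕ × ℕ × ℕ × ℕ × (Bool × Bool × Bool × Bool)) => comboCode (wordsOf l) a := by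
  let A := List (List Bool) × ℕ × ℕ × ℕ × ℕ × (Bool × Bool × Bool × Bool)
  have hn : Primrec fun a : A => a.2.1 := Primrec.fst.comp Primrec.snd
  have hA : Primrec fun a : (A × ℕ) × ℕ => a.1.1 := Primrec.fst.comp Primrec.fst
  exact Primrec.list_flatMap (Primrec.list_range.comp hn)
    (Primrec.list_map (Primrec.list_range.comp (hn.comp Primrec.fst))
      (primrec_combo.comp
        (((Primrec.fst.comp hA).pair (Primrec.snd.comp (Primrec.snd.comp hA))).pair
          ((Primrec.snd.comp Primrec.fst).pair Primrec.snd))).to₂).to₂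

/-- A decompressor for the patterns of the shift. -/
def decompress (M : Machine) (T : ℕ → ℕ) (p : List Bool) : List Bool :=
  ((Encodable.decode (α := ℕ × ℕ × ℕ × ℕ × (Bool × Bool × Bool × Bool))
    (numeral p).pred).map fun a => comboCode (wordsOf (prefixWords M T a.2.1)) a).getD []

theorem computable_decompress (M : Machine) {T : ℕ → ℕ} (hT : Computable T) :
    Computable (decompress M T) :=
  Computable.option_getD
    (Computable.option_map (Computable.decode.comp
      (Primrec.pred.comp primrec_numeral).to_comp)
      (primrec_comboCode.to_comp.comp
        ((computable_prefixWords M hT).comp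
          (Computable.fst.comp (Computable.snd.comp Computable.snd))) Computable.snd).to₂)
    (Computable.const [])

theorem pair_lt_pow_three {B a b : ℕ} (hB : 3 ≤ B) (ha : a ≤ B) (hb : b ≤ B) :
    Nat.pair a b < B ^ 3 :=
  calc Nat.pair a b < (max a b + 1) ^ 2 := Nat.pair_lt_max_add_one_sq a b
    _ ≤ (B + 1) ^ 2 := by gcongr; exact max_le ha hb
    _ ≤ B ^ 3 := by nlinarith [Nat.mul_le_mul hB hB]

/-- Each of the four nested pairings at most cubes the bound, and `3 ^ 4 = 81`. The number `101`
bounds the codes of the sign arrays. -/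
theorem encode_lt_pow {B n k i j : ℕ} (hn : n ≤ B) (hk : k ≤ B) (hi : i ≤ B) (hj : j ≤ B)
    (q : Bool × Bool × Bool × Bool) (hB : 101 ≤ B) :
    Encodable.encode (n, k, i, j, q) < B ^ 81 := by
  have hq : Encodable.encode q ≤ 101 := by revert q; decide
  have h3 {c : ℕ} (hc : 3 ≤ c) : 3 ≤ c ^ 3 ∧ c ≤ c ^ 3 :=
    ⟨hc.trans (Nat.le_self_pow (by norm_num) _), Nat.le_self_pow (by norm_num) _⟩
  have b0 : 3 ≤ B := by omega
  obtain ⟨b1, c1⟩ := h3 b0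
  obtain ⟨b2, c2⟩ := h3 b1
  obtain ⟨b3, c3⟩ := h3 b2
  have e1 := pair_lt_pow_three b0 hj (hq.trans hB)
  have e2 := pair_lt_pow_three b1 (hi.trans c1) e1.le
  have e3 := pair_lt_pow_three b2 (hk.trans (c1.trans c2)) e2.le
  have e4 := pair_lt_pow_three b3 (hn.trans (c1.trans (c2.trans c3))) e3.le
  rw [← pow_mul, ← pow_mul, ← pow_mul] at e4
  simpa only [Encodable.encode_prod_val, Encodable.encode_nat] using e4

/-- For the least `k` with `n ≤ side k`, the previous side is less than `n`. -/
theorem exists_side_bounds {n : ℕ} (hn : 1 ≤ n) : ∃ k, n ≤ side k ∧ side k ≤ 8 * n ^ 4 := by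
  classical
  have hex : ∃ k, n ≤ side k := ⟨n, (lt_side n).le⟩
  refine ⟨Nat.find hex, Nat.find_spec hex, ?_⟩
  rcases h : Nat.find hex with _ | k
  · have := pow_pos (show 0 < n by omega) 4
    rw [side]; omega
  · have := Nat.find_min hex (m := k) (by omega)
    rw [side]
    gcongr
    omega

theorem code_eq_flatMap {n : ℕ} (g : ℕ → ℕ → Bool) (P : Fin n → Fin n → Bool)
    (h : ∀ i j : Fin n, P i j = g i j) :
    code P = (List.range n).flatMap fun r => (List.range n).map fun s => g r s := by
  have ofFn_eq {α : Type} (f : Fin n → α) (f' : ℕ → α) (hf : ∀ i, f i = f' i) :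
      List.ofFn f = (List.range n).map f' :=
    List.ext_getElem (by simp) fun i h1 h2 => by simp [hf]
  rw [code, List.flatMap_def]
  congr 1
  exact ofFn_eq _ _ fun i => ofFn_eq _ _ fun j => h i j

theorem exists_decompress_eq (M : Machine) (T : ℕ → ℕ) {n : ℕ} (hn : 2 ≤ n)
    (P : Fin n → Fin n → Bool) (hP : GloballyAdmissible (blockShift (words M T)) P) :
    ∃ p, decompress M T p = code P ∧ 2 ^ p.length ≤ n ^ 567 := by
  obtain ⟨k, hnk, hk⟩ := exists_side_bounds (n := n) (by omega)
  obtain ⟨x, hx, v, hv⟩ := hP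
  obtain ⟨i, hi, j, hj, q, hq⟩ := hx k v
  have hB : 8 * n ^ 4 ≤ n ^ 7 := by
    have : 2 ^ 3 ≤ n ^ 3 := Nat.pow_le_pow_left hn 3
    calc 8 * n ^ 4 ≤ n ^ 3 * n ^ 4 := Nat.mul_le_mul_right _ this
      _ = n ^ 7 := by ring
  have h128 : 2 ^ 7 ≤ n ^ 7 := Nat.pow_le_pow_left hn 7
  have hkk := lt_side k
  -- As `n ≥ 2`, the power `n ^ 7` exceeds both `101` and `8 * n ^ 4`, which bounds the level and
  -- the offsets.
  have he := encode_lt_pow (B := n ^ 7) (n := n) (k := k) (i := i) (j := j)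
    (by omega) (by omega) (by omega) (by omega) q (by omega)
  rw [← pow_mul, show 7 * 81 = 567 from rfl] at he
  -- Numerals start at `1`, so the code is shifted by one; `decompress` undoes this with `pred`.
  obtain ⟨p, hp, hl⟩ := exists_numeral_eq (Encodable.encode (n, k, i, j, q) + 1) (by omega)
  refine ⟨p, ?_, hl.trans he⟩
  rw [decompress, hp, Nat.pred_succ, Encodable.encodek, Option.map_some, Option.getD_some,
    comboCode]
  refine (code_eq_flatMap _ P fun r s => ?_).symm
  rw [← hv r s, hq r (by omega) s (by omega)]
  exact combo_congr (fun m hm => (wordsOf_prefixWords M T hm).symm) _ _ _ _ _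

theorem plainComplexity_le_log {U : List Bool →. List Bool} (hU : IsOptimalDecompressor U)
    (M : Machine) {T : ℕ → ℕ} (hT : Computable T) :
    ∃ c : ℝ, 0 < c ∧ ∀ n : ℕ, 2 ≤ n → ∀ P : Fin n → Fin n → Bool,
      GloballyAdmissible (blockShift (words M T)) P →
        (plainComplexity U (code P) : ℝ≥0∞) ≤ ENNReal.ofReal (c * Real.log n) := by
  obtain ⟨c, hc⟩ := hU.2 (fun p => Part.some (decompress M T p)) (computable_decompress M hT)
  have h2 : 0 < Real.log 2 := Real.log_pos (by norm_num)
  refine ⟨(567 + c) / Real.log 2, by positivity, fun n hn P hP => ?_⟩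
  obtain ⟨p, hp, hl⟩ := exists_decompress_eq M T hn P hP
  have h1 : plainComplexity U (code P) ≤ ((p.length + c : ℕ) : ℕ∞) := by
    refine (hc _).trans ?_
    rw [Nat.cast_add]
    gcongr
    exact iInf₂_le p (by simp [hp])
  refine (ENat.toENNReal_le.2 h1).trans ?_
  rw [ENat.toENNReal_coe, ← ENNReal.ofReal_natCast]
  refine ENNReal.ofReal_le_ofReal ?_
  have hlog : Real.log 2 ≤ Real.log n := Real.log_le_log (by norm_num) (by exact_mod_cast hn)
  have hlen : p.length * Real.log 2 ≤ 567 * Real.log n := by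
    have := Real.log_le_log (by positivity) (show (2 : ℝ) ^ p.length ≤ (n : ℝ) ^ 567 by
      exact_mod_cast hl)
    simpa only [Real.log_pow, Nat.cast_ofNat] using this
  rw [div_mul_eq_mul_div, le_div_iff₀ h2]
  push_cast
  have : (c : ℝ) * Real.log 2 ≤ c * Real.log n := by gcongr
  linarith

/-- With `L = side k`, `2 * side (k + 1) = (4 * L ^ 2) ^ 2`, whose power `3 / 2` is `64 * L ^ 6`. -/
theorem half_mul_rpow_eq_bound (k : ℕ) :
    (1 / 2 : ℝ) * ((2 * side (k + 1) : ℕ) : ℝ) ^ (3 / 2 : ℝ) = bound k := by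
  have h : ((2 * side (k + 1) : ℕ) : ℝ) = (4 * (side k : ℝ) ^ 2) ^ (2 : ℝ) := by
    rw [Real.rpow_two, side]
    push_cast
    ring
  rw [h, ← Real.rpow_mul (by positivity), show (2 : ℝ) * (3 / 2) = (3 : ℕ) by norm_num,
    Real.rpow_natCast, bound]
  push_cast
  ring

end DeepShift

end

theorem mainTheorem6
    (U : List Bool →. List Bool) (hU : DeepShift.IsOptimalDecompressor U)
    (M : DeepShift.Machine) (hM : M.IsOptimal)
    (T : ℕ → ℕ) (hT : Computable T) :
    ∃ S : SymbolicDynamics.FullShift.Subshift Bool (ℤ × ℤ),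
      S.carrier.Nonempty ∧
      DeepShift.IsEffective S ∧ DeepShift.IsMinimal S ∧ DeepShift.IsTransitive S ∧
      (∃ c : ℝ, 0 < c ∧ ∀ n : ℕ, 2 ≤ n → ∀ P : Fin n → Fin n → Bool,
        DeepShift.GloballyAdmissible S P →
          (DeepShift.plainComplexity U (DeepShift.code P) : ℝ≥0∞) ≤
            ENNReal.ofReal (c * Real.log n)) ∧
      (∃ c : ℝ, 0 < c ∧ {n : ℕ | ∀ P : Fin n → Fin n → Bool,
        DeepShift.GloballyAdmissible S P →
          ENNReal.ofReal (c * (n : ℝ) ^ (3 / 2 : ℝ)) ≤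
            (M.complexity (T n) (DeepShift.code P) : ℝ≥0∞)}.Infinite) := by
  refine ⟨DeepShift.blockShift (DeepShift.words M T), DeepShift.blockShift_nonempty _,
    DeepShift.isEffective_blockShift M hT, DeepShift.isMinimal_blockShift _,
    DeepShift.isTransitive_blockShift _, DeepShift.plainComplexity_le_log hU M hT,
    1 / 2, by norm_num, ?_⟩
  -- Blocks of level at least `2` are used, because the word of level `0` is empty.
  refine Set.infinite_of_injective_forall_mem (f := fun k => 2 * DeepShift.side (k + 1 + 1))
    (fun a b h => ?_) fun k P hP => ?_
  · have := DeepShift.side_strictMono.injective (Nat.eq_of_mul_eq_mul_left two_pos h)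
    omega
  · rw [DeepShift.half_mul_rpow_eq_bound, ENNReal.ofReal_natCast, ← ENat.toENNReal_coe]
    exact ENat.toENNReal_le.2 (DeepShift.bound_le_complexity M T (Nat.le_add_left 1 k) P hP)
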